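/- Let $V$ be a finite-dimensional real Euclidean space and let $\Phi\subset V$ be a crystallographic root system, i.e. a finite set of nonzero vectors such that $s_\alpha(\beta)\in\Phi$ and $\langle\alpha,\beta^\vee\rangle\in\mathbb Z$ for all $\alpha,\beta\in\Phi$, and such that $\alpha,c\alpha\in\Phi$ with $c\in\mathbb R$ implies $c=\pm1$. Here $\beta^\vee=2\beta/\langle\beta,\beta\rangle$ and $s_\alpha(v)=v-\langle v,\alpha^\vee\rangle\alpha$. ($\Phi$ may be reducible, may be empty, and need not span $V$.) Let $W$ be the group generated by the reflections $s_\alpha$, $\alpha\in\Phi$. A simple system of a root system $\Psi$ is a linearly independent subset $\Gamma\subseteq\Psi$ such that $\Psi$ is the disjoint union of $\Psi_+:=\Psi\cap\mathbb R_{\ge0}\Gamma$ and $-\Psi_+$. A simple subsystem of $\Phi$ is a simple system of a root subsystem $\Phi_{W'}=\{\alpha\in\Phi\mid s_\alpha\in W'\}$, where $W'$ is a subgroup of $W$ generated by some of the reflections $s_\alpha$, $\alpha\in\Phi$. Let $L>0$ be a real number, and consider the simple subsystems $\Delta$ of $\Phi$ satisfying the following three conditions: (i) $\Delta$ is of type $A_1^n$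 for some $n\ge 0$, i.e. the Cartan matrix $(\langle\beta_i^\vee,\beta_j\rangle)_{i,j}$ of $\Delta=\{\beta_1,\dots,\beta_n\}$ is the Cartan matrix of type $A_1^n$; (ii) all roots in $\Delta$ have length $L$; (iii) $\Delta$ is maximal with respect to inclusion among the simple subsystems of $\Phi$ satisfying (i) and (ii). Then any two simple subsystems $\Delta,\Delta'$ of $\Phi$ satisfying (i)–(iii) are conjugate under $W$, i.e. there is $w\in W$ with $w(\Delta)=\Delta'$. -/

import Mathlib

open scoped NNReal Pointwise RealInnerProductSpace

namespace EuclideanRoots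

variable {V : Type*} [NormedAddCommGroup V] [InnerProductSpace ℝ V]

/-- The number `⟨v, α^∨⟩`, where `α^∨ = (2 / ⟨α, α⟩) α`. -/
noncomputable def pairing (v α : V) : ℝ := 2 * ⟪v, α⟫ / ⟪α, α⟫

/-- The orthogonal reflection `s_α` in the hyperplane orthogonal to `α`. -/
noncomputable def rootReflection (α : V) : V ≃ₗᵢ[ℝ] V := (Submodule.span ℝ {α})ᗮ.reflection

/-- Finite, reduced root systems; they need neither span `V` nor be crystallographic. -/
structure IsRootSystem (Φ : Set V) : Prop where
  finite : Φ.Finite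
  zero_notMem : (0 : V) ∉ Φ
  reflection_mem : ∀ α ∈ Φ, ∀ β ∈ Φ, rootReflection α β ∈ Φ
  reduced : ∀ α ∈ Φ, ∀ c : ℝ, c • α ∈ Φ → c = 1 ∨ c = -1

/-- `Φ` is crystallographic if `⟨α, β^∨⟩` is an integer for all `α, β ∈ Φ`. -/
def IsCrystallographic (Φ : Set V) : Prop :=
  ∀ α ∈ Φ, ∀ β ∈ Φ, ∃ k : ℤ, pairing α β = k

/-- The group `W` generated by the reflections in the elements of `Φ`. -/
noncomputable def weylGroup (Φ : Set V) : Subgroup (V ≃ₗᵢ[ℝ] V) :=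
  Subgroup.closure (rootReflection '' Φ)

/-- The elements of `Φ` that are nonnegative real linear combinations of elements of `Γ`. -/
def positivePart (Φ Γ : Set V) : Set V := Φ ∩ (Submodule.span ℝ≥0 Γ : Set V)

/-- `Γ` is a simple system of `Φ`: a linearly independent subset such that `Φ` is the disjoint
union of `Φ₊ = Φ ∩ ℝ≥0 Γ` and `-Φ₊`. -/
structure IsSimpleSystem (Φ Γ : Set V) : Prop where
  subset : Γ ⊆ Φ
  linearIndep : LinearIndepOn ℝ id Γ
  union_eq : positivePart Φ Γ ∪ -positivePart Φ Γ = Φ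
  disjoint : Disjoint (positivePart Φ Γ) (-positivePart Φ Γ)

/-- A reflection subgroup: a subgroup generated by some of the reflections in roots of `Φ`. -/
def IsReflectionSubgroup (Φ : Set V) (W' : Subgroup (V ≃ₗᵢ[ℝ] V)) : Prop :=
  ∃ A ⊆ rootReflection '' Φ, W' = Subgroup.closure A

/-- The root subsystem `{α ∈ Φ | s_α ∈ W'}` of `Φ` attached to `W'`. -/
def rootSubsystem (Φ : Set V) (W' : Subgroup (V ≃ₗᵢ[ℝ] V)) : Set V :=
  {α ∈ Φ | rootReflection α ∈ W'}

/-- A simple subsystem of `Φ`: a simple system of some root subsystem of `Φ`. -/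
def IsSimpleSubsystem (Φ Δ : Set V) : Prop :=
  ∃ W' : Subgroup (V ≃ₗᵢ[ℝ] V),
    IsReflectionSubgroup Φ W' ∧ IsSimpleSystem (rootSubsystem Φ W') Δ

/-- `Δ` has Cartan type `A`: for some indexing of the elements of `Δ` its matrix of the numbers
`⟨β_i^∨, β_j⟩` is `A`. -/
def HasCartanType {ι : Type*} (Δ : Set V) (A : Matrix ι ι ℤ) : Prop :=
  ∃ b : ι ≃ Δ, ∀ i j, pairing (b j : V) (b i : V) = A i j

/-- `Δ` is of type `A₁ⁿ`: its Cartan matrix is the block diagonal matrix with `n` blocks, each the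
Cartan matrix of type `A₁`. -/
def IsOfTypeA1Pow (Δ : Set V) (n : ℕ) : Prop :=
  HasCartanType Δ (Matrix.blockDiagonal fun _ : Fin n => CartanMatrix.A 1)

/-- Simple subsystems of `Φ` that are of type `A₁ⁿ` for some `n` and all of whose roots have
length `L`. -/
def IsA1SubsystemOfLength (Φ : Set V) (L : ℝ) (Δ : Set V) : Prop :=
  IsSimpleSubsystem Φ Δ ∧ (∃ n : ℕ, IsOfTypeA1Pow Δ n) ∧ ∀ α ∈ Δ, ‖α‖ = L

end EuclideanRoots

/-! The simple subsystems in question are the sets of pairwise orthogonal roots of length `L`. Given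
such sets `Δ` and `Δ'` with `Δ'` maximal, the elements of `Δ` are moved into `Δ'` one at a time.
Suppose `w` already maps `S ⊆ Δ` into `Δ'`, and let `α ∈ Δ \ S`. By maximality some `β ∈ Δ'` is not
orthogonal to `w α`. As these roots have the same length, they are conjugate under the reflections
in roots spanned by the two of them, and these reflections fix `w '' S` pointwise, since `w '' S` is
orthogonal both to `w α` and to `β`.
-/

namespace EuclideanRoots

variable {V : Type*} [NormedAddCommGroup V] [InnerProductSpace ℝ V]

theorem pairing_self {α : V} (hα : α ≠ 0) : pairing α α = 2 :=
  mul_div_cancel_right₀ _ (inner_self_ne_zero.2 hα)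

theorem pairing_eq_zero_iff {v α : V} : pairing v α = 0 ↔ ⟪v, α⟫ = 0 := by
  rcases eq_or_ne α 0 with rfl | hα
  · simp [pairing]
  · simp [pairing, hα]

theorem rootReflection_apply (α v : V) : rootReflection α v = v - pairing v α • α := by
  rw [rootReflection, Submodule.reflection_orthogonal_apply, Submodule.reflection_singleton_apply,
    pairing, real_inner_self_eq_norm_sq, real_inner_comm, mul_div_assoc, mul_smul, two_smul,
    two_smul, neg_sub]
  rfl

theorem rootReflection_self (α : V) : rootReflection α α = -α :=
  Submodule.reflection_orthogonalComplement_singleton_eq_neg α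

theorem rootReflection_neg (α : V) : rootReflection (-α) = rootReflection α := by
  simp only [rootReflection, ← Set.neg_singleton, Submodule.span_neg]

theorem rootReflection_inv (α : V) : (rootReflection α)⁻¹ = rootReflection α :=
  Submodule.reflection_inv

theorem rootReflection_apply_eq_self_iff {α v : V} : rootReflection α v = v ↔ ⟪v, α⟫ = 0 := by
  rw [rootReflection, Submodule.reflection_eq_self_iff,
    Submodule.mem_orthogonal_singleton_iff_inner_left]

theorem exists_smul_eq_of_rootReflection_apply_eq_neg {α v : V} (h : rootReflection α v = -v) :
    ∃ c : ℝ, c • α = v := by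
  rw [rootReflection_apply, sub_eq_iff_eq_add, neg_add_eq_sub, eq_sub_iff_add_eq, ← two_smul ℝ] at h
  exact ⟨2⁻¹ * pairing v α, by rw [mul_smul, ← h, inv_smul_smul₀ two_ne_zero]⟩

theorem weylGroup_mono {Ψ Φ : Set V} (h : Ψ ⊆ Φ) : weylGroup Ψ ≤ weylGroup Φ :=
  Subgroup.closure_mono (Set.image_mono h)

theorem rootReflection_mem_weylGroup {Ψ : Set V} {α : V} (hα : α ∈ Ψ) :
    rootReflection α ∈ weylGroup Ψ :=
  Subgroup.subset_closure ⟨α, hα, rfl⟩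

theorem mapsTo_of_mem_weylGroup {Ψ S : Set V} (h : ∀ α ∈ Ψ, Set.MapsTo (rootReflection α) S S)
    {w : V ≃ₗᵢ[ℝ] V} (hw : w ∈ weylGroup Ψ) : Set.MapsTo w S S := by
  induction hw using Subgroup.closure_induction'' with
  | mem _ hx => obtain ⟨α, hα, rfl⟩ := hx; exact h α hα
  | inv_mem _ hx => obtain ⟨α, hα, rfl⟩ := hx; rw [rootReflection_inv]; exact h α hα
  | one => exact Set.mapsTo_id S
  | mul _ _ _ _ hx hy => exact hx.comp hy

theorem IsRootSystem.neg_mem {Φ : Set V} (hΦ : IsRootSystem Φ) {α : V} (hα : α ∈ Φ) : -α ∈ Φ :=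
  rootReflection_self α ▸ hΦ.reflection_mem α hα α hα

theorem IsRootSystem.ne_zero {Φ : Set V} (hΦ : IsRootSystem Φ) {α : V} (hα : α ∈ Φ) : α ≠ 0 :=
  ne_of_mem_of_not_mem hα hΦ.zero_notMem

theorem IsRootSystem.setOf_norm_eq {Φ : Set V} (hΦ : IsRootSystem Φ) (L : ℝ) :
    IsRootSystem {α ∈ Φ | ‖α‖ = L} where
  finite := hΦ.finite.subset (Set.sep_subset _ _)
  zero_notMem h := hΦ.zero_notMem h.1
  reflection_mem α hα β hβ :=
    ⟨hΦ.reflection_mem α hα.1 β hβ.1, (LinearIsometryEquiv.norm_map _ _).trans hβ.2⟩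
  reduced α hα c hc := hΦ.reduced α hα.1 c hc.1

theorem pairing_eq_one {α β : V} (hnorm : ‖α‖ = ‖β‖) (hne : α ≠ β) (hpos : 0 < ⟪α, β⟫)
    (hint : ∃ k : ℤ, pairing α β = k) : pairing α β = 1 := by
  obtain ⟨k, hk⟩ := hint
  have hlt : ⟪α, β⟫ < ⟪β, β⟫ := by
    have hsub := real_inner_self_pos.2 (sub_ne_zero.2 hne)
    rw [real_inner_sub_sub_self, real_inner_self_eq_norm_sq α, hnorm,
      ← real_inner_self_eq_norm_sq] at hsub
    linarith
  have hββ : 0 < ⟪β, β⟫ := hpos.trans hlt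
  have hk_pos : 0 < (k : ℝ) := hk ▸ div_pos (mul_pos two_pos hpos) hββ
  have hk_lt : (k : ℝ) < 2 := by
    rw [← hk, pairing, div_lt_iff₀ hββ]
    linarith
  norm_cast at hk_pos hk_lt
  rw [hk, show k = 1 by omega, Int.cast_one]

/-- `Δ` is a set of pairwise orthogonal elements of `Ψ`. For `Ψ` the roots of length `L` of a root
system, these are its simple subsystems of type `A₁ⁿ` with roots of length `L`. -/
structure IsOrthogonalSubset (Ψ Δ : Set V) : Prop where
  subset : Δ ⊆ Ψ
  pairwise : Δ.Pairwise fun α β => ⟪α, β⟫ = 0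

theorem IsOrthogonalSubset.image {Ψ Δ : Set V} (hΔ : IsOrthogonalSubset Ψ Δ) {w : V ≃ₗᵢ[ℝ] V}
    (hw : Set.MapsTo w Ψ Ψ) : IsOrthogonalSubset Ψ (w '' Δ) where
  subset := (hw.mono_left hΔ.subset).image_subset
  pairwise := w.injective.injOn.pairwise_image.2 fun α hα β hβ hne =>
    (w.inner_map_map α β).trans (hΔ.pairwise hα hβ hne)

theorem IsOrthogonalSubset.exists_inner_ne_zero_of_maximal {Ψ Δ : Set V}
    (hΔ : Maximal (IsOrthogonalSubset Ψ) Δ) {α : V} (hα : α ∈ Ψ) (hα0 : α ≠ 0) :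
    ∃ β ∈ Δ, ⟪α, β⟫ ≠ 0 := by
  by_contra! horth
  have hinsert : IsOrthogonalSubset Ψ (insert α Δ) :=
    ⟨Set.insert_subset hα hΔ.prop.subset, Set.pairwise_insert.2 ⟨hΔ.prop.pairwise, fun β hβ _ =>
      ⟨horth β hβ, (real_inner_comm _ _).trans (horth β hβ)⟩⟩⟩
  have hαΔ : α ∈ Δ := hΔ.le_of_ge hinsert (Set.subset_insert α Δ) (Set.mem_insert α Δ)
  exact hα0 (inner_self_eq_zero.1 (horth α hαΔ))

section EqualLength

variable {Ψ Δ Δ' : Set V} {L : ℝ} {α β : V}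

theorem IsRootSystem.exists_mem_weylGroup_apply_eq_of_inner_pos (hΨ : IsRootSystem Ψ)
    (hcrys : IsCrystallographic Ψ) (hnorm : ∀ α ∈ Ψ, ‖α‖ = L) (hα : α ∈ Ψ) (hβ : β ∈ Ψ)
    (hpos : 0 < ⟪α, β⟫) :
    ∃ w ∈ weylGroup Ψ, w α = β ∧ ∀ v, ⟪v, α⟫ = 0 → ⟪v, β⟫ = 0 → w v = v := by
  rcases eq_or_ne α β with rfl | hne
  · exact ⟨1, one_mem _, rfl, fun _ _ _ => rfl⟩
  have hαβ : ‖α‖ = ‖β‖ := (hnorm α hα).trans (hnorm β hβ).symm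
  have hsub : α - β ∈ Ψ := by
    have h := hΨ.reflection_mem β hβ α hα
    rwa [rootReflection_apply, pairing_eq_one hαβ hne hpos (hcrys α hα β hβ), one_smul] at h
  refine ⟨rootReflection (α - β), rootReflection_mem_weylGroup hsub, Submodule.reflection_sub hαβ,
    fun v hvα hvβ => rootReflection_apply_eq_self_iff.2 ?_⟩
  rw [inner_sub_right, hvα, hvβ, sub_zero]

theorem IsRootSystem.exists_mem_weylGroup_apply_eq_of_inner_ne_zero (hΨ : IsRootSystem Ψ)
    (hcrys : IsCrystallographic Ψ) (hnorm : ∀ α ∈ Ψ, ‖α‖ = L) (hα : α ∈ Ψ) (hβ : β ∈ Ψ)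
    (hne : ⟪α, β⟫ ≠ 0) :
    ∃ w ∈ weylGroup Ψ, w α = β ∧ ∀ v, ⟪v, α⟫ = 0 → ⟪v, β⟫ = 0 → w v = v := by
  rcases hne.lt_or_gt with hneg | hpos
  · obtain ⟨w, hw, hwα, hfix⟩ :=
      hΨ.exists_mem_weylGroup_apply_eq_of_inner_pos hcrys hnorm (hΨ.neg_mem hα) hβ
        (by rwa [inner_neg_left, neg_pos])
    refine ⟨w * rootReflection α, mul_mem hw (rootReflection_mem_weylGroup hα), ?_,
      fun v hvα hvβ => ?_⟩
    · rw [LinearIsometryEquiv.coe_mul, Function.comp_apply, rootReflection_self, hwα]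
    · rw [LinearIsometryEquiv.coe_mul, Function.comp_apply, rootReflection_apply_eq_self_iff.2 hvα,
        hfix v (by rw [inner_neg_right, hvα, neg_zero]) hvβ]
  · exact hΨ.exists_mem_weylGroup_apply_eq_of_inner_pos hcrys hnorm hα hβ hpos

theorem IsOrthogonalSubset.exists_image_subset_of_maximal (hΨ : IsRootSystem Ψ)
    (hcrys : IsCrystallographic Ψ) (hnorm : ∀ α ∈ Ψ, ‖α‖ = L) (hΔ : IsOrthogonalSubset Ψ Δ)
    (hΔ' : Maximal (IsOrthogonalSubset Ψ) Δ') : ∃ w ∈ weylGroup Ψ, w '' Δ ⊆ Δ' := by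
  induction Δ, hΨ.finite.subset hΔ.subset using Set.Finite.induction_on with
  | empty => exact ⟨1, one_mem _, by simp only [Set.image_empty, Set.empty_subset]⟩
  | @insert α S hαS _ ih =>
    obtain ⟨hS, horth⟩ := (Set.pairwise_insert_of_notMem hαS).1 hΔ.pairwise
    have hαΨ : α ∈ Ψ := hΔ.subset (Set.mem_insert α S)
    obtain ⟨w, hw, hwS⟩ := ih ⟨(Set.subset_insert α S).trans hΔ.subset, hS⟩
    have hwα : w α ∈ Ψ := mapsTo_of_mem_weylGroup hΨ.reflection_mem hw hαΨ
    obtain ⟨β, hβ, hne⟩ := exists_inner_ne_zero_of_maximal hΔ' hwα (hΨ.ne_zero hwα)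
    obtain ⟨g, hg, hgα, hfix⟩ :=
      hΨ.exists_mem_weylGroup_apply_eq_of_inner_ne_zero hcrys hnorm hwα (hΔ'.prop.subset hβ) hne
    have hgS : ∀ γ ∈ S, g (w γ) = w γ := fun γ hγ => by
      have hγα : ⟪w γ, w α⟫ = 0 := (w.inner_map_map γ α).trans (horth γ hγ).2
      have hγβ : w γ ≠ β := fun h => hne (by rw [← h, real_inner_comm, hγα])
      exact hfix _ hγα (hΔ'.prop.pairwise (hwS ⟨γ, hγ, rfl⟩) hβ hγβ)
    refine ⟨g * w, mul_mem hg hw, Set.image_subset_iff.2 (Set.insert_subset ?_ fun γ hγ => ?_)⟩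
    · rwa [Set.mem_preimage, LinearIsometryEquiv.coe_mul, Function.comp_apply, hgα]
    · rw [Set.mem_preimage, LinearIsometryEquiv.coe_mul, Function.comp_apply, hgS γ hγ]
      exact hwS ⟨γ, hγ, rfl⟩

theorem IsOrthogonalSubset.exists_image_eq_of_maximal (hΨ : IsRootSystem Ψ)
    (hcrys : IsCrystallographic Ψ) (hnorm : ∀ α ∈ Ψ, ‖α‖ = L)
    (hΔ : Maximal (IsOrthogonalSubset Ψ) Δ) (hΔ' : Maximal (IsOrthogonalSubset Ψ) Δ') :
    ∃ w ∈ weylGroup Ψ, w '' Δ = Δ' := by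
  obtain ⟨w, hw, hsub⟩ := exists_image_subset_of_maximal hΨ hcrys hnorm hΔ'.prop hΔ
  have hwΔ : IsOrthogonalSubset Ψ ((w⁻¹ : V ≃ₗᵢ[ℝ] V) '' Δ) :=
    hΔ.prop.image (mapsTo_of_mem_weylGroup hΨ.reflection_mem (inv_mem hw))
  exact ⟨w⁻¹, inv_mem hw, hΔ'.eq_of_superset hwΔ fun γ hγ =>
    ⟨w γ, hsub ⟨γ, hγ, rfl⟩, w.symm_apply_apply γ⟩⟩

end EqualLength

theorem apply_eq_or_eq_neg_of_mem_weylGroup {Δ : Set V} (hΔ : Δ.Pairwise fun α β => ⟪α, β⟫ = 0)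
    {β : V} (hβ : β ∈ Δ) {w : V ≃ₗᵢ[ℝ] V} (hw : w ∈ weylGroup Δ) : w β = β ∨ w β = -β := by
  have hmaps : ∀ α ∈ Δ, Set.MapsTo (rootReflection α) {β, -β} {β, -β} := fun α hα => by
    rcases eq_or_ne β α with rfl | hne
    · rintro _ (rfl | rfl) <;> simp [rootReflection_self]
    · rintro _ (rfl | rfl) <;> simp [rootReflection_apply_eq_self_iff.2 (hΔ hβ hα hne)]
  exact mapsTo_of_mem_weylGroup hmaps hw (Set.mem_insert β _)

theorem apply_eq_self_of_mem_weylGroup {Δ : Set V} {v : V} (h : ∀ α ∈ Δ, ⟪v, α⟫ = 0)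
    {w : V ≃ₗᵢ[ℝ] V} (hw : w ∈ weylGroup Δ) : w v = v :=
  mapsTo_of_mem_weylGroup (S := {v})
    (fun α hα => Set.mapsTo_singleton.2 (rootReflection_apply_eq_self_iff.2 (h α hα))) hw rfl

theorem IsOrthogonalSubset.mem_or_neg_mem_of_rootReflection_mem_weylGroup {Φ Δ : Set V}
    (hΦ : IsRootSystem Φ) (hΔ : IsOrthogonalSubset Φ Δ) {α : V} (hα : α ∈ Φ)
    (hs : rootReflection α ∈ weylGroup Δ) : α ∈ Δ ∨ -α ∈ Δ := by
  obtain ⟨β, hβ, hne⟩ : ∃ β ∈ Δ, ⟪β, α⟫ ≠ 0 := by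
    by_contra! horth
    have hfix : rootReflection α α = α :=
      apply_eq_self_of_mem_weylGroup (fun β hβ => (real_inner_comm _ _).trans (horth β hβ)) hs
    exact hΦ.ne_zero hα (inner_self_eq_zero.1 (rootReflection_apply_eq_self_iff.1 hfix))
  have hβneg : rootReflection α β = -β :=
    (apply_eq_or_eq_neg_of_mem_weylGroup hΔ.pairwise hβ hs).resolve_left
      (mt rootReflection_apply_eq_self_iff.1 hne)
  obtain ⟨c, rfl⟩ := exists_smul_eq_of_rootReflection_apply_eq_neg hβneg
  rcases hΦ.reduced α hα c (hΔ.subset hβ) with rfl | rfl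
  · exact Or.inl (by rwa [one_smul] at hβ)
  · exact Or.inr (by rwa [neg_one_smul] at hβ)

theorem IsOrthogonalSubset.rootSubsystem_weylGroup {Φ Δ : Set V} (hΦ : IsRootSystem Φ)
    (hΔ : IsOrthogonalSubset Φ Δ) : rootSubsystem Φ (weylGroup Δ) = Δ ∪ -Δ := by
  refine Set.Subset.antisymm
    (fun α hα => hΔ.mem_or_neg_mem_of_rootReflection_mem_weylGroup hΦ hα.1 hα.2) ?_
  rintro α (hα | hα)
  · exact ⟨hΔ.subset hα, rootReflection_mem_weylGroup hα⟩
  · exact ⟨neg_neg α ▸ hΦ.neg_mem (hΔ.subset hα),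
      rootReflection_neg α ▸ rootReflection_mem_weylGroup hα⟩

theorem inner_nonneg_of_mem_span_nnreal {S : Set V} {u v : V} (hS : ∀ x ∈ S, 0 ≤ ⟪x, u⟫)
    (hv : v ∈ Submodule.span ℝ≥0 S) : 0 ≤ ⟪v, u⟫ := by
  induction hv using Submodule.span_induction with
  | mem x hx => exact hS x hx
  | zero => rw [inner_zero_left]
  | add x y _ _ hx hy => rw [inner_add_left]; exact add_nonneg hx hy
  | smul a x _ hx => rw [NNReal.smul_def, real_inner_smul_left]; exact mul_nonneg a.2 hx

theorem notMem_span_nnreal_of_neg_mem {Δ : Set V} (h0 : 0 ∉ Δ)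
    (hΔ : Δ.Pairwise fun α β => ⟪α, β⟫ = 0) {α : V} (hα : -α ∈ Δ) :
    α ∉ Submodule.span ℝ≥0 Δ := fun hspan => by
  have hnonneg : ∀ x ∈ Δ, 0 ≤ ⟪x, -α⟫ := fun x hx => by
    rcases eq_or_ne x (-α) with rfl | hne
    · exact real_inner_self_nonneg
    · exact (hΔ hx hα hne).ge
  have hle : 0 ≤ ⟪α, -α⟫ := inner_nonneg_of_mem_span_nnreal hnonneg hspan
  have hα0 : α ≠ 0 := neg_ne_zero.1 (ne_of_mem_of_not_mem hα h0)
  rw [inner_neg_right, neg_nonneg] at hle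
  exact hle.not_gt (real_inner_self_pos.2 hα0)

theorem positivePart_union_neg {Δ : Set V} (h0 : 0 ∉ Δ)
    (hΔ : Δ.Pairwise fun α β => ⟪α, β⟫ = 0) : positivePart (Δ ∪ -Δ) Δ = Δ := by
  refine Set.Subset.antisymm ?_ fun α hα => ⟨Or.inl hα, Submodule.subset_span hα⟩
  rintro α ⟨hα | hα, hspan⟩
  · exact hα
  · exact absurd hspan (notMem_span_nnreal_of_neg_mem h0 hΔ hα)

theorem isSimpleSystem_union_neg {Δ : Set V} (h0 : 0 ∉ Δ)
    (hΔ : Δ.Pairwise fun α β => ⟪α, β⟫ = 0) : IsSimpleSystem (Δ ∪ -Δ) Δ where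
  subset := Set.subset_union_left
  linearIndep := linearIndependent_of_ne_zero_of_inner_eq_zero (𝕜 := ℝ)
    (fun i : Δ => ne_of_mem_of_not_mem i.2 h0)
    fun i j hij => hΔ i.2 j.2 (Subtype.coe_injective.ne hij)
  union_eq := by rw [positivePart_union_neg h0 hΔ]
  disjoint := by
    rw [positivePart_union_neg h0 hΔ, Set.disjoint_left]
    exact fun α hα hneg => notMem_span_nnreal_of_neg_mem h0 hΔ hneg (Submodule.subset_span hα)

theorem IsOrthogonalSubset.isSimpleSubsystem {Φ Δ : Set V} (hΦ : IsRootSystem Φ)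
    (hΔ : IsOrthogonalSubset Φ Δ) : IsSimpleSubsystem Φ Δ := by
  refine ⟨weylGroup Δ, ⟨_, Set.image_mono hΔ.subset, rfl⟩, ?_⟩
  rw [hΔ.rootSubsystem_weylGroup hΦ]
  exact isSimpleSystem_union_neg (fun h => hΦ.zero_notMem (hΔ.subset h)) hΔ.pairwise

theorem blockDiagonal_cartanMatrix_A_one {ι : Type*} [DecidableEq ι] (i j : Fin 1 × ι) :
    Matrix.blockDiagonal (fun _ : ι => CartanMatrix.A 1) i j = if i = j then 2 else 0 := by
  simp [Matrix.blockDiagonal_apply, Prod.ext_iff, Subsingleton.elim i.1 j.1, CartanMatrix.A]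

theorem exists_isOfTypeA1Pow_iff {Δ : Set V} (h0 : 0 ∉ Δ) :
    (∃ n, IsOfTypeA1Pow Δ n) ↔ Δ.Finite ∧ Δ.Pairwise fun α β => ⟪α, β⟫ = 0 := by
  constructor
  · rintro ⟨n, b, hb⟩
    refine ⟨Set.finite_coe_iff.1 (Finite.of_equiv _ b), fun α hα β hβ hne => ?_⟩
    obtain ⟨i, hi⟩ := b.surjective ⟨α, hα⟩
    obtain ⟨j, hj⟩ := b.surjective ⟨β, hβ⟩
    have hji : j ≠ i := by
      rintro rfl
      exact hne (congrArg Subtype.val (hi.symm.trans hj))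
    have hpair := hb j i
    rwa [blockDiagonal_cartanMatrix_A_one, if_neg hji, Int.cast_zero, pairing_eq_zero_iff, hi,
      hj] at hpair
  · rintro ⟨hfin, hΔ⟩
    have := hfin.to_subtype
    obtain ⟨n, ⟨e⟩⟩ := Finite.exists_equiv_fin Δ
    refine ⟨n, (Equiv.uniqueProd (Fin n) (Fin 1)).trans e.symm, fun i j => ?_⟩
    rw [blockDiagonal_cartanMatrix_A_one]
    rcases eq_or_ne i j with rfl | hij
    · rw [if_pos rfl, pairing_self (ne_of_mem_of_not_mem (Subtype.coe_prop _) h0), Int.cast_ofNat]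
    · rw [if_neg hij, Int.cast_zero, pairing_eq_zero_iff]
      exact hΔ (Subtype.coe_prop _) (Subtype.coe_prop _)
        (Subtype.coe_injective.ne ((Equiv.injective _).ne hij.symm))

theorem isA1SubsystemOfLength_iff {Φ : Set V} (hΦ : IsRootSystem Φ) {L : ℝ} {Δ : Set V} :
    IsA1SubsystemOfLength Φ L Δ ↔ IsOrthogonalSubset {α ∈ Φ | ‖α‖ = L} Δ := by
  constructor
  · rintro ⟨⟨_, _, hs⟩, htype, hlen⟩
    have hsub : Δ ⊆ Φ := fun α hα => (hs.subset hα).1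
    exact ⟨fun α hα => ⟨hsub hα, hlen α hα⟩,
      ((exists_isOfTypeA1Pow_iff fun h => hΦ.zero_notMem (hsub h)).1 htype).2⟩
  · rintro ⟨hsub, horth⟩
    have hsub' : Δ ⊆ Φ := fun α hα => (hsub hα).1
    exact ⟨IsOrthogonalSubset.isSimpleSubsystem hΦ ⟨hsub', horth⟩,
      (exists_isOfTypeA1Pow_iff fun h => hΦ.zero_notMem (hsub' h)).2
        ⟨hΦ.finite.subset hsub', horth⟩, fun α hα => (hsub hα).2⟩

end EuclideanRoots

theorem proposition5p3_general {V : Type*} [NormedAddCommGroup V] [InnerProductSpace ℝ V]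
    (Φ : Set V) (hΦ : EuclideanRoots.IsRootSystem Φ) (L : ℝ)
    (hcrys : EuclideanRoots.IsCrystallographic {α ∈ Φ | ‖α‖ = L}) (Δ Δ' : Set V)
    (hΔ : Maximal (EuclideanRoots.IsA1SubsystemOfLength Φ L) Δ)
    (hΔ' : Maximal (EuclideanRoots.IsA1SubsystemOfLength Φ L) Δ') :
    ∃ w ∈ EuclideanRoots.weylGroup {α ∈ Φ | ‖α‖ = L}, w '' Δ = Δ' := by
  have heq : EuclideanRoots.IsA1SubsystemOfLength Φ L =
      EuclideanRoots.IsOrthogonalSubset {α ∈ Φ | ‖α‖ = L} :=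
    funext fun _ => propext (EuclideanRoots.isA1SubsystemOfLength_iff hΦ)
  rw [heq] at hΔ hΔ'
  exact EuclideanRoots.IsOrthogonalSubset.exists_image_eq_of_maximal (hΦ.setOf_norm_eq L) hcrys
    (fun _ hα => hα.2) hΔ hΔ'

theorem proposition5p3 {V : Type*} [NormedAddCommGroup V] [InnerProductSpace ℝ V]
    [FiniteDimensional ℝ V] (Φ : Set V) (hΦ : EuclideanRoots.IsRootSystem Φ)
    (hcrys : EuclideanRoots.IsCrystallographic Φ) (L : ℝ) (hL : 0 < L) (Δ Δ' : Set V)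
    (hΔ : Maximal (EuclideanRoots.IsA1SubsystemOfLength Φ L) Δ)
    (hΔ' : Maximal (EuclideanRoots.IsA1SubsystemOfLength Φ L) Δ') :
    ∃ w ∈ EuclideanRoots.weylGroup Φ, w '' Δ = Δ' := by
  obtain ⟨w, hw, h⟩ :=
    proposition5p3_general Φ hΦ L (fun α hα β hβ => hcrys α hα.1 β hβ.1) Δ Δ' hΔ hΔ'
  exact ⟨w, EuclideanRoots.weylGroup_mono (Set.sep_subset _ _) hw, h⟩
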